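/- A multi-layer graph $\mathcal G=(V,\{C_1,C_2\},R)$ consists of a finite vertex set $V$ and edge sets $C_1\neq C_2$ (the cop layers) and $R$ (the robber layer) on $V$; a layer $E$ is connected if the graph $(V,E)$ is. In the game on $\mathcal G$ with $m$ cops, the cop player assigns each cop to one of the layers $C_1,C_2$ and places it on a vertex, and then the robber chooses a vertex. The players then alternate, cops first: on the cops' turn each cop stays or moves along one edge of its own layer, on the robber's turn the robber stays or moves along one edge of $R$. The cops win if at some point a cop and the robber occupy the same vertex; the robber wins by evading capture forever. The multi-layer cop number $\mathrm{mc}(\mathcal G)$ is the least $m$ for which the cop player has a winning strategy with $m$ cops, and $\mathrm c(V,E)$ is the ordinary cop number of the graph $(V,E)$, where the cops and the robber all move along $E$. **Theorem.** There is an absolute constant $K$ such that for every positive integer $k$ there is a multi-layer graph $\mathcal G=(V,\{C_1,C_2\},R)$ with $|V|\le K k^3$ such that: - each of $(V,R)$, $(V,C_1)$ and $(V,C_2)$ is connected, - $\mathrm c(V,R)\le 3$, - $\mathrm c(V,C_i)\le 2$ for $i\in\{1,2\}$, and - $\mathrm{mc}(\mathcal G)\ge k$. Consequently the multi-layer cop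 number is not bounded above by any function of the cop numbers of the layers: there is no function $f:\mathbb N^3\to\mathbb N$ such that $\mathrm{mc}(\mathcal G)\le f(\mathrm c(V,C_1),\mathrm c(V,C_2),\mathrm c(V,R))$ for all multi-layer graphs $\mathcal G=(V,\{C_1,C_2\},R)$ with all layers connected. -/

import Mathlib

namespace CopsRobbers

/-- A token standing on `u` may, on its turn, stay on `u` or move along one edge of `G`. -/
def Step {V : Type*} (G : SimpleGraph V) (u v : V) : Prop := u = v ∨ G.Adj u v

/-- The vertices occupied by the robber at times `0, …, t - 1`, most recent first. -/
def history {V : Type*} (r : ℕ → V) : ℕ → List V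
  | 0 => []
  | t + 1 => r t :: history r t

/-- A strategy of the cop player, for a set `ι` of cops where cop `i` moves in the graph `A i`.
`pos h i` is where cop `i` stands after the robber has occupied the vertices listed in `h`
(most recent first) and the cops have answered; `pos []` is the initial placement, chosen
before the robber chooses a vertex. -/
structure CopStrategy {V ι : Type*} (A : ι → SimpleGraph V) where
  pos : List V → ι → V
  legal : ∀ (h : List V) (v : V) (i : ι), Step (A i) (pos h i) (pos (v :: h) i)

/-- A play of the robber: a starting vertex `r 0`, then on each turn he stays or moves along
one edge of `R`. -/
def IsRobberPlay {V : Type*} (R : SimpleGraph V) (r : ℕ → V) : Prop :=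
  ∀ t, Step R (r t) (r (t + 1))

/-- Some cop catches the robber: when the robber has just placed himself on `r t`, a cop
stands there already, or moves there on the following turn of the cops. -/
def CopStrategy.Catches {V ι : Type*} {A : ι → SimpleGraph V} (σ : CopStrategy A)
    (r : ℕ → V) : Prop :=
  ∃ (t : ℕ) (i : ι), σ.pos (history r t) i = r t ∨ σ.pos (history r (t + 1)) i = r t

/-- The cop player has a winning strategy when cop `i` moves in `A i` and the robber in `R`. -/
def CopsWin {V ι : Type*} (A : ι → SimpleGraph V) (R : SimpleGraph V) : Prop :=
  ∃ σ : CopStrategy A, ∀ r : ℕ → V, IsRobberPlay R r → σ.Catches r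

/-- The cop number of a graph: the least number of cops with a winning strategy. -/
noncomputable def copNumber {V : Type*} (G : SimpleGraph V) : ℕ :=
  sInf {k : ℕ | CopsWin (fun _ : Fin k => G) G}

/-- A multi-layer graph on `V` with `τ` cop layers and a robber layer. -/
structure MultiLayerGraph (V : Type*) (τ : ℕ) where
  copLayer : Fin τ → SimpleGraph V
  robberLayer : SimpleGraph V

namespace MultiLayerGraph

variable {V : Type*} {τ : ℕ}

/-- The cop player wins with the allocation `a`, i.e. with exactly `a i` cops on layer `i`. -/
def AllocatedCopsWin (G : MultiLayerGraph V τ) (a : Fin τ → ℕ) : Prop :=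
  CopsWin (fun c : (i : Fin τ) × Fin (a i) => G.copLayer c.1) G.robberLayer

/-- The cop player wins with `k` cops in total, having chosen their allocation to layers. -/
def CopsWinWith (G : MultiLayerGraph V τ) (k : ℕ) : Prop :=
  ∃ a : Fin τ → ℕ, ∑ i, a i = k ∧ G.AllocatedCopsWin a

/-- The multi-layer cop number: the least total number of cops with which the cop player wins. -/
noncomputable def multiLayerCopNumber (G : MultiLayerGraph V τ) : ℕ :=
  sInf {k : ℕ | G.CopsWinWith k}

/-- All layers, those of the cops and that of the robber, are connected on the whole of `V`. -/
def AllConnected (G : MultiLayerGraph V τ) : Prop :=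
  (∀ i, (G.copLayer i).Connected) ∧ G.robberLayer.Connected

end MultiLayerGraph

/-- If every vertex can be given its own cop, the cops win. -/
theorem copsWin_of_surjective {V ι : Type*} (A : ι → SimpleGraph V) (R : SimpleGraph V)
    (f : ι → V) (hf : Function.Surjective f) : CopsWin A R := by
  refine ⟨⟨fun _ => f, fun _ _ _ => Or.inl rfl⟩, fun r _ => ?_⟩
  obtain ⟨i, hi⟩ := hf (r 0)
  exact ⟨0, i, Or.inl hi⟩

/-- On a finite graph the minimum in the definition of the cop number is attained. -/
theorem copsWin_copNumber {V : Type*} [Finite V] (G : SimpleGraph V) :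
    CopsWin (fun _ : Fin (copNumber G) => G) G := by
  have h : {k : ℕ | CopsWin (fun _ : Fin k => G) G}.Nonempty :=
    ⟨Nat.card V, copsWin_of_surjective _ _ _ (Finite.equivFin V).symm.surjective⟩
  exact Nat.sInf_mem h

/-- On a finite multi-layer graph with at least one cop layer the minimum in the definition of
the multi-layer cop number is attained. -/
theorem MultiLayerGraph.copsWinWith_multiLayerCopNumber {V : Type*} [Finite V] {τ : ℕ}
    (hτ : 0 < τ) (G : MultiLayerGraph V τ) : G.CopsWinWith G.multiLayerCopNumber := by
  have h : {k : ℕ | G.CopsWinWith k}.Nonempty := by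
    refine ⟨_, fun _ => Nat.card V, rfl, ?_⟩
    refine copsWin_of_surjective _ _ (fun c => (Finite.equivFin V).symm c.2) fun v => ?_
    exact ⟨⟨⟨0, hτ⟩, Finite.equivFin V v⟩, by simp⟩
  exact Nat.sInf_mem h

end CopsRobbers

namespace CopsRobbers

/-! The layers need not resemble each other, so a fast robber can face slow cops. The robber layer
is complete and both cop layers are Hamiltonian paths on `3 * k` vertices; each layer alone has cop
number at most 1. A cop on a path threatens at most three vertices, so fewer than `k` cops, however
allocated, leave some vertex unthreatened, and the robber can jump there every turn
(`not_copsWin_top`). The vertex count is thus linear in `k`, well within the cubic bound. The second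
claim follows because a function `f` is bounded on the finitely many triples of cop numbers that
occur, while `k` is arbitrary. -/

/-! ### A robber on a complete graph evades few cops of bounded degree -/

/-- The history of the play in which the robber always answers the history `h` by `f h`. -/
def answerHistory {V : Type*} (f : List V → V) : ℕ → List V
  | 0 => []
  | t + 1 => f (answerHistory f t) :: answerHistory f t

theorem history_answerHistory {V : Type*} (f : List V → V) (t : ℕ) :
    history (fun s => f (answerHistory f s)) t = answerHistory f t := by
  induction t with
  | zero => rfl
  | succ t ih => simp only [history, answerHistory, ih]

/-- If every closed neighbourhood in the graphs of the cops has at most `d` vertices and the cops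
are too few for such neighbourhoods to cover all vertices, then a robber who may move to any vertex
always has a vertex that no cop can reach on the next turn. -/
theorem not_copsWin_top {V ι : Type*} [Fintype V] [Fintype ι] (A : ι → SimpleGraph V) (d : ℕ)
    (N : ι → V → Finset V) (hN : ∀ i u v, Step (A i) u v → v ∈ N i u)
    (hd : ∀ i u, (N i u).card ≤ d) (h : Fintype.card ι * d < Fintype.card V) :
    ¬ CopsWin A ⊤ := by
  classical
  rintro ⟨σ, hσ⟩
  have hsafe : ∀ l : List V, ∃ v, ∀ i, v ∉ N i (σ.pos l i) := by
    intro l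
    by_contra! hl
    have huniv : (Finset.univ : Finset V) ⊆ Finset.univ.biUnion fun i => N i (σ.pos l i) := by
      intro v _
      obtain ⟨i, hi⟩ := hl v
      exact Finset.mem_biUnion.2 ⟨i, Finset.mem_univ i, hi⟩
    have hle := (Finset.card_le_card huniv).trans
      (Finset.card_biUnion_le_card_mul _ _ d fun i _ => hd i _)
    simp only [Finset.card_univ] at hle
    omega
  choose f hf using hsafe
  obtain ⟨t, i, hc⟩ := hσ (fun s => f (answerHistory f s)) fun t => by
    simpa only [Step, SimpleGraph.top_adj] using eq_or_ne _ _
  simp only [history_answerHistory] at hc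
  -- The robber's vertex was chosen outside what cop `i` can reach from its current position;
  -- standing there already and moving there are both such steps.
  refine hf (answerHistory f t) i (hN i _ _ ?_)
  rcases hc with hc | hc
  · exact Or.inl hc
  · exact hc ▸ σ.legal (answerHistory f t) (f (answerHistory f t)) i

theorem copNumber_top_le_one {V : Type*} [Nonempty V] : copNumber (⊤ : SimpleGraph V) ≤ 1 := by
  -- The cop jumps to the robber's latest vertex; the default value is its initial placement.
  refine Nat.sInf_le ⟨⟨fun h _ => h.headD (Classical.arbitrary V), fun h v i => ?_⟩, fun r _ => ?_⟩
  · simpa only [Step, SimpleGraph.top_adj] using eq_or_ne _ _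
  · exact ⟨0, 0, Or.inr rfl⟩

/-! ### Paths with relabelled vertices -/

/-- The path on `V` that visits the vertices in the order of their labels under `e`. -/
def labelledPath {V : Type*} {n : ℕ} (e : V ≃ Fin n) : SimpleGraph V :=
  (SimpleGraph.pathGraph n).comap e

theorem labelledPath_adj {V : Type*} {n : ℕ} (e : V ≃ Fin n) (u v : V) :
    (labelledPath e).Adj u v ↔
      (e u : ℕ) + 1 = e v ∨ (e v : ℕ) + 1 = e u := by
  simp [labelledPath, SimpleGraph.pathGraph_adj]

theorem labelledPath_connected {V : Type*} {n : ℕ} (e : V ≃ Fin (n + 1)) :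
    (labelledPath e).Connected :=
  (SimpleGraph.Iso.connected_iff (SimpleGraph.Iso.comap e (SimpleGraph.pathGraph (n + 1)))).2
    (SimpleGraph.pathGraph_connected n)

/-- A cop walking along a path from end to end catches the robber, who cannot pass it. -/
theorem copNumber_labelledPath_le_one {V : Type*} {n : ℕ} (e : V ≃ Fin (n + 1)) :
    copNumber (labelledPath e) ≤ 1 := by
  refine Nat.sInf_le ⟨⟨fun h _ => e.symm ⟨min h.length n, by omega⟩, fun h v i => ?_⟩,
    fun r hr => ?_⟩
  · by_cases hn : h.length < n
    · right
      simp only [labelledPath_adj, Equiv.apply_symm_apply, List.length_cons]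
      omega
    · left
      congr 2
      simp only [List.length_cons]
      omega
  · by_contra hc
    have hlen : ∀ t, (history r t).length = t := by
      intro t
      induction t with
      | zero => rfl
      | succ t ih => simp only [history, List.length_cons, ih]
    simp only [CopStrategy.Catches, not_exists, not_or, hlen, Equiv.symm_apply_eq, Fin.ext_iff]
      at hc
    -- An uncaught robber stays strictly ahead of the cop: the cop's advance cannot land on the
    -- robber, and the robber's reply, changing the label by at most one, cannot cross the cop. At
    -- time `n` no label is left.
    have hlt : ∀ t, min t n < (e (r t) : ℕ) := by
      intro t
      induction t with
      | zero => have := (hc 0 0).1; omega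
      | succ t ih =>
        have h1 := (hc t 0).2
        have h2 := (hc (t + 1) 0).1
        rcases hr t with h | h
        · rw [← h] at h2 ⊢
          omega
        · rw [labelledPath_adj] at h
          omega
    have := hlt n
    have := (e (r n)).isLt
    omega

/-- The vertices whose label under `e` differs by at most one from that of `u`. -/
def labelBall {V : Type*} [Fintype V] {n : ℕ} (e : V ≃ Fin n) (u : V) : Finset V :=
  {v | (e v : ℕ) ∈ Finset.Icc ((e u : ℕ) - 1) (e u + 1)}

theorem mem_labelBall_of_step {V : Type*} [Fintype V] {n : ℕ} (e : V ≃ Fin n) (u v : V)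
    (h : Step (labelledPath e) u v) : v ∈ labelBall e u := by
  simp only [labelBall, Finset.mem_filter, Finset.mem_univ, true_and, Finset.mem_Icc]
  rcases h with rfl | h
  · omega
  · rw [labelledPath_adj] at h
    omega

theorem card_labelBall_le {V : Type*} [Fintype V] {n : ℕ} (e : V ≃ Fin n) (u : V) :
    (labelBall e u).card ≤ 3 := by
  -- At label 0 the truncated subtraction only shortens the interval, so 3 remains a bound.
  refine (Finset.card_le_card_of_injOn (t := Finset.Icc ((e u : ℕ) - 1) (e u + 1))
    (fun v => (e v : ℕ)) (fun v hv => ?_) fun v _ w _ h => ?_).trans ?_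
  · simpa [labelBall] using hv
  · exact e.injective (Fin.ext h)
  · rw [Nat.card_Icc]
    omega

/-! ### Slow cops on two paths and a robber on a complete graph -/

/-- Two relabelled paths as cop layers and the complete graph as robber layer. -/
def pathsVersusTop {V : Type*} {n : ℕ} (e : Fin 2 → V ≃ Fin n) : MultiLayerGraph V 2 where
  copLayer i := labelledPath (e i)
  robberLayer := ⊤

/-- The bound of three threatened vertices is the same on both paths, so only the total number of
cops matters, not the allocation. -/
theorem le_multiLayerCopNumber_pathsVersusTop {V : Type*} [Fintype V] {n k : ℕ}
    (e : Fin 2 → V ≃ Fin n) (hk : 3 * k ≤ n) :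
    k ≤ (pathsVersusTop e).multiLayerCopNumber := by
  obtain ⟨a, ha, hwin⟩ :=
    MultiLayerGraph.copsWinWith_multiLayerCopNumber two_pos (pathsVersusTop e)
  by_contra! hlt
  refine not_copsWin_top (fun c : (i : Fin 2) × Fin (a i) => labelledPath (e c.1)) 3
    (fun c => labelBall (e c.1)) (fun c => mem_labelBall_of_step (e c.1))
    (fun c => card_labelBall_le (e c.1)) ?_ hwin
  have hV : Fintype.card V = n := by simpa using Fintype.card_congr (e 0)
  simp only [Fintype.card_sigma, Fintype.card_fin, ha, hV]
  omega

/-- The edge between 1 and 2 is lost after the swap, where these vertices carry the labels 0 and 2.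
-/
theorem labelledPath_refl_ne_swap (n : ℕ) :
    labelledPath (Equiv.refl (Fin (n + 3))) ≠ labelledPath (Equiv.swap 0 1) := by
  intro h
  have hadj : (labelledPath (Equiv.refl (Fin (n + 3)))).Adj 1 2 := by
    rw [labelledPath_adj]
    left
    rfl
  have h2 : 2 % (n + 3) = 2 := Nat.mod_eq_of_lt (by omega)
  rw [h, labelledPath_adj, Equiv.swap_apply_right,
    Equiv.swap_apply_of_ne_of_ne (by simp [Fin.ext_iff, h2]) (by simp [Fin.ext_iff, h2])] at hadj
  simp [h2] at hadj

theorem exists_multiLayerGraph_le_multiLayerCopNumber (k : ℕ) (hk : 1 ≤ k) :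
    ∃ (V : Type) (_ : Fintype V) (G : MultiLayerGraph V 2),
      Fintype.card V ≤ 3 * k ^ 3 ∧
      G.copLayer 0 ≠ G.copLayer 1 ∧
      G.AllConnected ∧
      copNumber G.robberLayer ≤ 3 ∧
      (∀ i, copNumber (G.copLayer i) ≤ 2) ∧
      k ≤ G.multiLayerCopNumber := by
  obtain ⟨m, rfl⟩ : ∃ m, k = m + 1 := ⟨k - 1, by omega⟩
  let e : Fin 2 → Fin (3 * m + 3) ≃ Fin (3 * m + 3) := ![Equiv.refl _, Equiv.swap 0 1]
  refine ⟨Fin (3 * m + 3), inferInstance, pathsVersusTop e, ?_,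
    labelledPath_refl_ne_swap (3 * m), ⟨fun i => labelledPath_connected (e i),
      SimpleGraph.connected_top⟩, copNumber_top_le_one.trans (by norm_num),
    fun i => (copNumber_labelledPath_le_one (e i)).trans one_le_two,
    le_multiLayerCopNumber_pathsVersusTop e (by omega)⟩
  rw [Fintype.card_fin]
  have := Nat.le_self_pow three_ne_zero (m + 1)
  omega

end CopsRobbers

theorem mainTheorem2 :
    (∃ K : ℕ, ∀ k : ℕ, 1 ≤ k →
      ∃ (V : Type) (_ : Fintype V) (G : CopsRobbers.MultiLayerGraph V 2),
        Fintype.card V ≤ K * k ^ 3 ∧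
        G.copLayer 0 ≠ G.copLayer 1 ∧
        G.AllConnected ∧
        CopsRobbers.copNumber G.robberLayer ≤ 3 ∧
        (∀ i, CopsRobbers.copNumber (G.copLayer i) ≤ 2) ∧
        k ≤ G.multiLayerCopNumber) ∧
    ¬ ∃ f : ℕ → ℕ → ℕ → ℕ,
      ∀ (V : Type) (_ : Fintype V) (G : CopsRobbers.MultiLayerGraph V 2),
        G.copLayer 0 ≠ G.copLayer 1 → G.AllConnected →
        G.multiLayerCopNumber ≤
          f (CopsRobbers.copNumber (G.copLayer 0)) (CopsRobbers.copNumber (G.copLayer 1))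
            (CopsRobbers.copNumber G.robberLayer) := by
  refine ⟨⟨3, CopsRobbers.exists_multiLayerGraph_le_multiLayerCopNumber⟩, ?_⟩
  rintro ⟨f, hf⟩
  -- This finite box contains all triples of cop numbers allowed by the bounds 2, 2, 3; asking for
  -- one more cop than the maximum of `f` on it gives the contradiction.
  let s : Finset (ℕ × ℕ × ℕ) := Finset.range 3 ×ˢ Finset.range 3 ×ˢ Finset.range 4
  let g : ℕ × ℕ × ℕ → ℕ := fun p => f p.1 p.2.1 p.2.2
  obtain ⟨V, hV, G, -, hne, hconn, hR, hC, hk⟩ :=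
    CopsRobbers.exists_multiLayerGraph_le_multiLayerCopNumber (s.sup g + 1) (by omega)
  have hmem : (CopsRobbers.copNumber (G.copLayer 0), CopsRobbers.copNumber (G.copLayer 1),
      CopsRobbers.copNumber G.robberLayer) ∈ s := by
    have := hC 0
    have := hC 1
    simp only [s, Finset.mem_product, Finset.mem_range]
    omega
  have hle := Finset.le_sup (f := g) hmem
  have := hf V hV G hne hconn
  exact absurd ((hk.trans this).trans hle) (by omega)
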